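/- Let $(\Omega,\mathcal F,\mathbb P)$ be a probability space with a discrete time filtration $(\mathcal F_k)_{k\ge 0}$ that has atomless innovations, i.e. for each $k\ge 1$ there is an $\mathcal F_k$-measurable random variable $U_k$, uniformly distributed on $[0,1]$, that is independent of $\mathcal F_{k-1}$. Let $(X_k)_{k\ge 0}$ be an $\mathbb R^m$-valued martingale with respect to $(\mathcal F_k)$ with $X_k\in L^2$ for all $k$ and $X_0=0$ almost surely. Write $\Vert Y\Vert=(\mathbb E[|Y|^2])^{1/2}$, where $|\cdot|$ is the Euclidean norm. Then there is a sequence $(Z^n)_{n\ge 1}$ of $\mathbb R^m$-valued martingales $Z^n=(Z^n_k)_{k\ge 0}$ with respect to $(\mathcal F_k)$, with $Z^n_k\in L^2$ and $Z^n_0=0$, such that 1. for all $n\ge 1$ and $k\ge 1$, the increment $Z^n_k-Z^n_{k-1}$ is independent of $\mathcal F_{k-1}$; 2. for each $k$, $X_k=\sum_{n\ge 1} Z^n_k$, where the partial sums converge in $L^2$; 3. for each $k$, $\Vert X_k\Vert^2=\sum_{n\ge 1}\Vert Z^n_k\Vert^2$; 4. each $Z^n$ has independent increments: for each $n$ the differences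 $(Z^n_k-Z^n_{k-1})_{k\ge 1}$ form an independent system. -/

import Mathlib

open MeasureTheory ProbabilityTheory Filter Topology
open scoped ENNReal

/-- A discrete-time filtration has atomless innovations if, for every `k ≥ 1` (written `k + 1`),
there is an `ℱ k`-measurable random variable, uniformly distributed on `[0,1]`, that is
independent of `ℱ (k - 1)`. -/
def HasAtomlessInnovations {Ω : Type*} {mΩ : MeasurableSpace Ω} (ℱ : Filtration ℕ mΩ)
    (P : Measure Ω) : Prop :=
  ∀ k : ℕ, ∃ U : Ω → ℝ,
    Measurable[ℱ (k + 1)] U ∧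
    pdf.IsUniform U (Set.Icc 0 1) P volume ∧
    Indep (MeasurableSpace.comap U inferInstance) (ℱ k) P

/-! It suffices to expand each increment of `X` in innovations, i.e. centered `ℱ (k + 1)`-measurable
variables independent of `ℱ k`; `Z n` then adds up the `n`-th innovations of the steps, and
Parseval's identity passes from steps to sums by Pythagoras.

Innovations are closed under scaling but in general not under addition, so orthogonal projection is
replaced by a weak greedy algorithm (`exists_hasSum_sq_norm_of_cone`): repeatedly subtract from the
residual its projection on a nearly best direction. Each subtraction is orthogonal to the new
residual, which gives Parseval although the terms need not be mutually orthogonal.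

The residual tends to `0` because no nonzero element of the ambient space is orthogonal to all
innovations: given `R` with `E[R | F] = 0`, `R ≠ 0`, a conditional quantile transform yields `V`
independent of `F` with `E[V R] > 0` (`exists_indepFun_integral_mul_pos`). -/

/-- For a square-summable sequence `a`, the products `a m * ∑_{j ≤ m} a j` are arbitrarily small
infinitely often. -/
lemma exists_ge_mul_sum_range_lt {a : ℕ → ℝ}
    (hs : Summable fun n => a n ^ 2) {ε : ℝ} (hε : 0 < ε) (N : ℕ) :
    ∃ m ≥ N, a m * ∑ j ∈ Finset.range (m + 1), a j < ε := by
  by_contra! h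
  set C := ∑' n, a n ^ 2
  have hC : 0 ≤ C := tsum_nonneg fun n => sq_nonneg _
  have hS : ∀ m, (∑ j ∈ Finset.range (m + 1), a j) ^ 2 ≤ (m + 1 : ℝ) * C := fun m => by
    calc (∑ j ∈ Finset.range (m + 1), a j) ^ 2
        ≤ (Finset.range (m + 1)).card * ∑ j ∈ Finset.range (m + 1), a j ^ 2 :=
          sq_sum_le_card_mul_sum_sq
      _ ≤ (m + 1 : ℝ) * C := by
          rw [Finset.card_range]
          push_cast
          gcongr
          exact hs.sum_le_tsum _ fun i _ => sq_nonneg _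
  -- If all products were at least `ε`, the Cauchy–Schwarz bound `hS` would make `C * a m ^ 2`
  -- dominate a multiple of the harmonic series.
  have key : ∀ m ≥ N, ε ^ 2 * (1 / ((m : ℝ) + 1)) ≤ C * a m ^ 2 := fun m hm => by
    have h1 : ε ^ 2 ≤ (a m * ∑ j ∈ Finset.range (m + 1), a j) ^ 2 :=
      pow_le_pow_left₀ hε.le (h m hm) 2
    rw [mul_pow] at h1
    rw [mul_one_div, div_le_iff₀ (by positivity)]
    nlinarith [hS m, sq_nonneg (a m)]
  have h2 : Summable fun m : ℕ => ε ^ 2 * (1 / (((m + N : ℕ) : ℝ) + 1)) := by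
    refine Summable.of_nonneg_of_le (fun m => by positivity) (fun m => key (m + N) (by omega)) ?_
    exact ((summable_nat_add_iff N).2 hs).mul_left C
  rw [summable_mul_left_iff (by positivity)] at h2
  have h3 := (summable_nat_add_iff (f := fun m : ℕ => 1 / ((m : ℝ) + 1)) N).1 h2
  have h4 := (summable_nat_add_iff (f := fun m : ℕ => 1 / (m : ℝ)) 1).1 (by simpa using h3)
  exact Real.not_summable_one_div_natCast h4

/-! ### Weak greedy expansion over a cone -/

section Greedy

variable {H : Type*} [NormedAddCommGroup H] [InnerProductSpace ℝ H]

/-- One step of the weak greedy algorithm. -/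
lemma exists_greedy_step {S : Set H} (h0 : (0 : H) ∈ S) (hsmul : ∀ y ∈ S, ∀ c : ℝ, c • y ∈ S)
    (x : H) :
    ∃ y ∈ S, inner ℝ x y = ‖y‖ ^ 2 ∧ ∀ z ∈ S, |inner ℝ x z| ≤ 2 * ‖y‖ * ‖z‖ := by
  set T : Set ℝ := {r | ∃ g ∈ S, ‖g‖ = 1 ∧ r = |inner ℝ x g|}
  have hb : BddAbove T := ⟨‖x‖, by
    rintro _ ⟨g, -, hg, rfl⟩
    simpa [hg] using abs_real_inner_le_norm x g⟩
  have hle : ∀ z ∈ S, |inner ℝ x z| ≤ sSup T * ‖z‖ := fun z hz => by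
    rcases eq_or_ne z 0 with rfl | hz0
    · simp
    · have hn : 0 < ‖z‖ := norm_pos_iff.2 hz0
      have : |inner ℝ x (‖z‖⁻¹ • z)| ≤ sSup T := le_csSup hb
        ⟨_, hsmul z hz _, by rw [norm_smul, norm_inv, norm_norm, inv_mul_cancel₀ hn.ne'], rfl⟩
      rwa [real_inner_smul_right, abs_mul, abs_inv, abs_norm, inv_mul_le_iff₀ hn, mul_comm] at this
  -- An empty `T` (no unit vector in `S`) has default `sSup T = 0` and falls in the first case.
  -- Otherwise the supremum need not be attained; a direction reaching half of it costs the factor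
  -- `2`.
  rcases le_or_gt (sSup T) 0 with hs | hs
  · refine ⟨0, h0, by simp, fun z hz => (hle z hz).trans ?_⟩
    simpa using mul_nonpos_of_nonpos_of_nonneg hs (norm_nonneg z)
  · have hne : T.Nonempty := by
      by_contra h
      rw [Set.not_nonempty_iff_eq_empty] at h
      simp [h] at hs
    obtain ⟨_, ⟨g, hg, hg1, rfl⟩, hlt⟩ := exists_lt_of_lt_csSup hne (half_lt_self hs)
    have hy : ‖(inner ℝ x g : ℝ) • g‖ = |inner ℝ x g| := by rw [norm_smul, hg1, mul_one]; rfl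
    refine ⟨(inner ℝ x g : ℝ) • g, hsmul g hg _, ?_, fun z hz => (hle z hz).trans ?_⟩
    · rw [hy, real_inner_smul_right, sq_abs, sq]
    · rw [hy]
      gcongr
      linarith

/-- Convergence of the weak greedy algorithm: if `S` is a cone in a closed subspace `K` of a Hilbert
space and only `0` in `K` is orthogonal to `S`, then each element of `K` is the sum of a series in
`S` whose terms satisfy Parseval's identity. -/
theorem exists_hasSum_sq_norm_of_cone [CompleteSpace H] {S : Set H} (K : Submodule ℝ H)
    (hK : IsClosed (K : Set H)) (hSK : S ⊆ K) (h0 : (0 : H) ∈ S)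
    (hsmul : ∀ y ∈ S, ∀ c : ℝ, c • y ∈ S)
    (hperp : ∀ z ∈ K, (∀ y ∈ S, inner ℝ z y = 0) → z = 0) {x : H} (hx : x ∈ K) :
    ∃ y : ℕ → H, (∀ n, y n ∈ S) ∧
      Tendsto (fun N => ∑ n ∈ Finset.range N, y n) atTop (𝓝 x) ∧
      HasSum (fun n => ‖y n‖ ^ 2) (‖x‖ ^ 2) := by
  choose f hfS hf1 hf2 using exists_greedy_step h0 hsmul
  let r : ℕ → H := fun n => Nat.rec x (fun _ z => z - f z) n
  have hr : ∀ n, r (n + 1) = r n - f (r n) := fun n => rfl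
  let y : ℕ → H := fun n => f (r n)
  have hsum : ∀ n, ∑ j ∈ Finset.range n, y j = x - r n := fun n => by
    induction n with
    | zero => simp [r]
    | succ n ih => rw [Finset.sum_range_succ, ih, hr]; simp only [y]; abel
  have hdiff : ∀ n m, n ≤ m → r n - r m = ∑ j ∈ Finset.Ico n m, y j := fun n m h => by
    rw [Finset.sum_Ico_eq_sub _ h, hsum, hsum]; abel
  have hnorm : ∀ n, ‖r (n + 1)‖ ^ 2 = ‖r n‖ ^ 2 - ‖y n‖ ^ 2 := fun n => by
    rw [hr, norm_sub_sq_real, hf1]; ring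
  have hnsum : ∀ n, ∑ j ∈ Finset.range n, ‖y j‖ ^ 2 = ‖x‖ ^ 2 - ‖r n‖ ^ 2 := fun n => by
    induction n with
    | zero => simp [r]
    | succ n ih => rw [Finset.sum_range_succ, ih, hnorm]; ring
  have hsq : Summable fun n => ‖y n‖ ^ 2 :=
    summable_of_sum_range_le (c := ‖x‖ ^ 2) (fun n => sq_nonneg _) fun n => by
      rw [hnsum]; nlinarith [sq_nonneg ‖r n‖]
  have hanti : Antitone fun n => ‖r n‖ ^ 2 := antitone_nat_of_succ_le fun n => by
    rw [hnorm]; nlinarith [sq_nonneg ‖y n‖]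
  -- The cross term is a sum of `⟨r m, y j⟩`, each bounded through the near-optimality of `y m` at
  -- stage `m`.
  have hest : ∀ n m, n ≤ m → ‖r n - r m‖ ^ 2 ≤
      ‖r n‖ ^ 2 - ‖r m‖ ^ 2 + 4 * (‖y m‖ * ∑ j ∈ Finset.range (m + 1), ‖y j‖) := fun n m h => by
    have e1 : ‖r n - r m‖ ^ 2 = ‖r n‖ ^ 2 - ‖r m‖ ^ 2 - 2 * inner ℝ (r m) (r n - r m) := by
      rw [norm_sub_sq_real, inner_sub_right, real_inner_self_eq_norm_sq,
        real_inner_comm (r n) (r m)]; ring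
    have e2 : |inner ℝ (r m) (r n - r m)| ≤
        2 * (‖y m‖ * ∑ j ∈ Finset.range (m + 1), ‖y j‖) := by
      rw [hdiff n m h, inner_sum]
      calc |∑ j ∈ Finset.Ico n m, inner ℝ (r m) (y j)|
          ≤ ∑ j ∈ Finset.Ico n m, |inner ℝ (r m) (y j)| := Finset.abs_sum_le_sum_abs _ _
        _ ≤ ∑ j ∈ Finset.Ico n m, 2 * ‖y m‖ * ‖y j‖ :=
            Finset.sum_le_sum fun j _ => hf2 _ _ (hfS _)
        _ ≤ ∑ j ∈ Finset.range (m + 1), 2 * ‖y m‖ * ‖y j‖ := by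
            refine Finset.sum_le_sum_of_subset_of_nonneg ?_ fun _ _ _ => by positivity
            intro j hj
            simp only [Finset.mem_Ico, Finset.mem_range] at *
            omega
        _ = 2 * (‖y m‖ * ∑ j ∈ Finset.range (m + 1), ‖y j‖) := by
            rw [← Finset.mul_sum]; ring
    rw [e1]
    linarith [neg_abs_le (inner ℝ (r m) (r n - r m) : ℝ)]
  have hlim : ∃ l, Tendsto (fun n => ‖r n‖ ^ 2) atTop (𝓝 l) :=
    ⟨_, tendsto_atTop_ciInf hanti ⟨0, by rintro _ ⟨n, rfl⟩; exact sq_nonneg _⟩⟩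
  obtain ⟨l, hl⟩ := hlim
  have hcauchy : CauchySeq r := by
    rw [Metric.cauchySeq_iff']
    intro ε hε
    obtain ⟨N, hN⟩ := (hl.eventually (gt_mem_nhds
      (lt_add_of_pos_right l (show 0 < ε ^ 2 / 16 by positivity)))).exists_forall_of_atTop
    have hl' : ∀ n, l ≤ ‖r n‖ ^ 2 := fun n => hanti.le_of_tendsto hl n
    refine ⟨N, fun n hn => ?_⟩
    -- Both `r n` and `r N` are compared with one later `r m` whose error term is small: `ε² / 16 +
    -- 4 * (ε² / 64) < (ε / 2)²`.
    obtain ⟨m, hm, hlt⟩ := exists_ge_mul_sum_range_lt hsq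
      (show 0 < ε ^ 2 / 64 by positivity) n
    have key : ∀ k, N ≤ k → k ≤ m → ‖r k - r m‖ < ε / 2 := fun k hk hkm => by
      refine lt_of_pow_lt_pow_left₀ 2 (half_pos hε).le ?_
      have := hest k m hkm
      have := hN k hk
      have := hl' m
      nlinarith [sq_pos_of_pos hε]
    have h1 := key n hn hm
    have h2 := key N le_rfl (hn.trans hm)
    calc dist (r n) (r N) ≤ dist (r n) (r m) + dist (r N) (r m) := dist_triangle_right _ _ _
      _ < ε := by rw [dist_eq_norm, dist_eq_norm]; linarith
  obtain ⟨z, hz⟩ := cauchySeq_tendsto_of_complete hcauchy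
  have hrK : ∀ n, r n ∈ K := fun n => by
    induction n with
    | zero => exact hx
    | succ n ih => rw [hr]; exact K.sub_mem ih (hSK (hfS _))
  have hy0 : Tendsto (fun n => ‖y n‖) atTop (𝓝 0) := by
    have := (Real.continuous_sqrt.tendsto 0).comp hsq.tendsto_atTop_zero
    simpa [Function.comp_def, Real.sqrt_sq] using this
  have hz0 : z = 0 := by
    refine hperp z (hK.mem_of_tendsto hz (Eventually.of_forall hrK)) fun g hg => ?_
    have h1 : Tendsto (fun n => |inner ℝ (r n) g|) atTop (𝓝 |inner ℝ z g|) :=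
      (hz.inner tendsto_const_nhds).abs
    have h2 : Tendsto (fun n => 2 * ‖y n‖ * ‖g‖) atTop (𝓝 (2 * 0 * ‖g‖)) :=
      (hy0.const_mul 2).mul_const _
    have := le_of_tendsto_of_tendsto' h1 h2 fun n => hf2 _ g hg
    simpa using this
  subst hz0
  refine ⟨y, fun n => hfS _, ?_, ?_⟩
  · simp_rw [hsum]
    simpa using hz.const_sub x
  · rw [hasSum_iff_tendsto_nat_of_nonneg fun _ => sq_nonneg _]
    simp_rw [hnsum]
    simpa using (hz.norm.pow 2).const_sub (‖x‖ ^ 2)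

end Greedy

/-! ### Probability integral transform -/

/-- The probability integral transform: the distribution function of an atomless law pushes
that law forward to the uniform law on `[0,1]`. -/
lemma map_real_Iic_eq_volume_restrict (μ : Measure ℝ) [IsProbabilityMeasure μ] [NullSingletonClass μ] :
    μ.map (fun x => μ.real (Set.Iic x)) = volume.restrict (Set.Icc 0 1) := by
  set F : ℝ → ℝ := fun x => μ.real (Set.Iic x)
  have hFcdf : F = cdf μ := funext fun x => (cdf_eq_real μ x).symm
  have hmono : Monotone F := hFcdf ▸ monotone_cdf μ
  have hcont : Continuous F := by
    rw [hFcdf, continuous_iff_continuousAt]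
    intro x
    rw [(monotone_cdf μ).continuousAt_iff_leftLim_eq_rightLim,
      ((cdf μ).right_continuous x).rightLim_eq]
    have h := (cdf μ).measure_singleton x
    rw [measure_cdf, measure_singleton, eq_comm, ENNReal.ofReal_eq_zero] at h
    exact le_antisymm ((monotone_cdf μ).leftLim_le le_rfl) (by linarith)
  have hbot : Tendsto F atBot (𝓝 0) := hFcdf ▸ tendsto_cdf_atBot μ
  have htop : Tendsto F atTop (𝓝 1) := hFcdf ▸ tendsto_cdf_atTop μ
  have hsurj : ∀ s ∈ Set.Ioo (0 : ℝ) 1, ∃ x, F x = s := fun s hs =>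
    mem_range_of_exists_le_of_exists_ge hcont
      (((hbot.eventually (gt_mem_nhds hs.1)).exists).imp fun _ h => h.le)
      (((htop.eventually (lt_mem_nhds hs.2)).exists).imp fun _ h => h.le)
  have hF0 : ∀ x, 0 ≤ F x := fun x => measureReal_nonneg
  have hF1 : ∀ x, F x ≤ 1 := fun x => measureReal_le_one
  -- `F` may have flat pieces, so `{F ≤ t}` is sandwiched between half-lines ending at preimages of
  -- `t` and of any `s > t`.
  have hle : ∀ t s, 0 ≤ t → t < s → s < 1 → μ.real {x | F x ≤ t} ≤ s := fun t s h0 hts h1 => by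
    obtain ⟨x, rfl⟩ := hsurj s ⟨h0.trans_lt hts, h1⟩
    refine measureReal_mono fun y hy => ?_
    by_contra hxy
    exact absurd (hmono (not_le.1 hxy).le) (not_le.2 (lt_of_le_of_lt hy hts))
  have hge : ∀ t, 0 < t → t < 1 → t ≤ μ.real {x | F x ≤ t} := fun t h0 h1 => by
    obtain ⟨x, rfl⟩ := hsurj t ⟨h0, h1⟩
    exact measureReal_mono fun y hy => hmono hy
  have hmain : ∀ t, μ.real {x | F x ≤ t} = max (min t 1) 0 := fun t => by
    rcases lt_or_ge t 0 with ht | ht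
    · have : {x | F x ≤ t} = ∅ := Set.eq_empty_of_forall_notMem fun x hx =>
        absurd (hF0 x) (not_le.2 (lt_of_le_of_lt hx ht))
      rw [this, max_eq_right ((min_le_left _ _).trans ht.le), measureReal_empty]
    rcases le_or_gt 1 t with ht1 | ht1
    · have : {x | F x ≤ t} = Set.univ := Set.eq_univ_of_forall fun x => (hF1 x).trans ht1
      rw [this, min_eq_right ht1, probReal_univ]
      norm_num
    · rw [min_eq_left ht1.le, max_eq_left ht]
      refine le_antisymm (le_of_forall_gt_imp_ge_of_dense fun s hs => ?_) ?_
      · rcases lt_or_ge s 1 with h | h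
        · exact hle t s ht hs h
        · exact measureReal_le_one.trans h
      · rcases ht.eq_or_lt with rfl | ht0
        · exact measureReal_nonneg
        · exact hge t ht0 ht1
  refine Measure.ext_of_Iic _ _ fun t => ?_
  rw [Measure.map_apply hcont.measurable measurableSet_Iic,
    Measure.restrict_apply measurableSet_Iic]
  have e1 : F ⁻¹' Set.Iic t = {x | F x ≤ t} := rfl
  have e2 : Set.Iic t ∩ Set.Icc 0 1 = Set.Icc 0 (min t 1) := by
    ext x
    simp only [Set.mem_inter_iff, Set.mem_Iic, Set.mem_Icc, le_min_iff]
    tauto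
  rw [e1, e2, Real.volume_Icc, sub_zero, ← ofReal_measureReal, hmain]
  simp [ENNReal.ofReal, Real.toNNReal]

/-! ### Conditional quantile transform -/

section ConditionalQuantile

variable {Ω β : Type*} {mΩ : MeasurableSpace Ω} {mβ : MeasurableSpace β}

lemma measurable_kernel_real_Iic (κ : Kernel β ℝ) [IsMarkovKernel κ] :
    Measurable fun p : β × ℝ => (κ p.1).real (Set.Iic p.2) := by
  have hs : MeasurableSet {q : (β × ℝ) × ℝ | q.2 ≤ q.1.2} :=
    measurableSet_le measurable_snd (measurable_snd.comp measurable_fst)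
  exact (Kernel.measurable_kernel_prodMk_left (κ := κ.comap Prod.fst measurable_fst)
    hs).ennreal_toReal

lemma measurable_real_Iic (μ : Measure ℝ) [IsFiniteMeasure μ] :
    Measurable fun x => μ.real (Set.Iic x) :=
  Monotone.measurable fun _ _ h => measureReal_mono (Set.Iic_subset_Iic.2 h)

variable {P : Measure Ω} [IsProbabilityMeasure P] {X : Ω → β} {W : Ω → ℝ}

/-- Disintegrate the law of `(X, W)` over `X`: on almost every fibre the transform is uniform, with
a law not depending on the fibre. -/
lemma measure_preimage_inter_kernel_real_Iic (hX : Measurable X) (hW : Measurable W)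
    (hna : ∀ᵐ b ∂P.map X, NullSingletonClass (condDistrib W X P b)) {B : Set ℝ} (hB : MeasurableSet B)
    {D : Set β} (hD : MeasurableSet D) :
    P ((fun ω => (condDistrib W X P (X ω)).real (Set.Iic (W ω))) ⁻¹' B ∩ X ⁻¹' D) =
      volume.restrict (Set.Icc 0 1) B * P (X ⁻¹' D) := by
  set κ := condDistrib W X P
  have hg := measurable_kernel_real_Iic κ
  set s : Set (β × ℝ) := (fun p : β × ℝ => (κ p.1).real (Set.Iic p.2)) ⁻¹' B ∩ Prod.fst ⁻¹' D
  have hs : MeasurableSet s := (hg hB).inter (measurable_fst hD)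
  have h1 : P ((fun ω => (κ (X ω)).real (Set.Iic (W ω))) ⁻¹' B ∩ X ⁻¹' D) =
      P.map (fun ω => (X ω, W ω)) s := by
    rw [Measure.map_apply (hX.prodMk hW) hs]; rfl
  rw [h1, ← compProd_map_condDistrib hW.aemeasurable, Measure.compProd_apply hs,
    ← Measure.map_apply hX hD, ← setLIntegral_const, ← lintegral_indicator hD]
  refine lintegral_congr_ae ?_
  filter_upwards [hna] with b hb
  by_cases hbD : b ∈ D
  · rw [Set.indicator_of_mem hbD, ← map_real_Iic_eq_volume_restrict (κ b),
      Measure.map_apply (measurable_real_Iic _) hB]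
    congr 1
    ext x
    simp [s, hbD]
  · rw [Set.indicator_of_notMem hbD]
    convert measure_empty (μ := κ b)
    ext x
    simp [s, hbD]

lemma indepFun_kernel_real_Iic (hX : Measurable X) (hW : Measurable W)
    (hna : ∀ᵐ b ∂P.map X, NullSingletonClass (condDistrib W X P b)) :
    IndepFun (fun ω => (condDistrib W X P (X ω)).real (Set.Iic (W ω))) X P := by
  rw [indepFun_iff_measure_inter_preimage_eq_mul]
  intro B D hB hD
  have h := measure_preimage_inter_kernel_real_Iic hX hW hna hB MeasurableSet.univ
  rw [Set.preimage_univ, Set.inter_univ, measure_univ, mul_one] at h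
  rw [measure_preimage_inter_kernel_real_Iic hX hW hna hB hD, h]

/-- On each fibre a uniform variable misses the fixed value `c b` almost surely. This later gives
strict positivity of a correlation. -/
lemma ae_kernel_real_Iic_ne (hX : Measurable X) (hW : Measurable W)
    (hna : ∀ᵐ b ∂P.map X, NullSingletonClass (condDistrib W X P b)) {c : β → ℝ}
    (hc : Measurable c) :
    ∀ᵐ ω ∂P, (condDistrib W X P (X ω)).real (Set.Iic (W ω)) ≠ c (X ω) := by
  set κ := condDistrib W X P
  have hg := measurable_kernel_real_Iic κ
  have hs : MeasurableSet {p : β × ℝ | (κ p.1).real (Set.Iic p.2) = c p.1} :=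
    measurableSet_eq_fun hg (hc.comp measurable_fst)
  have h : P.map (fun ω => (X ω, W ω)) {p | (κ p.1).real (Set.Iic p.2) = c p.1} = 0 := by
    rw [← compProd_map_condDistrib hW.aemeasurable, Measure.compProd_apply hs,
      lintegral_eq_zero_iff (Kernel.measurable_kernel_prodMk_left hs)]
    filter_upwards [hna] with b hb
    have : κ b ((fun x => (κ b).real (Set.Iic x)) ⁻¹' {c b}) = 0 := by
      rw [← Measure.map_apply (measurable_real_Iic _) (measurableSet_singleton _),
        map_real_Iic_eq_volume_restrict, measure_singleton]
    exact this
  rw [Measure.map_apply (hX.prodMk hW) hs] at h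
  exact measure_eq_zero_iff_ae_notMem.1 h

lemma condDistrib_ae_eq_map_of_indepFun (hX : Measurable X) (hW : Measurable W)
    (h : IndepFun X W P) : condDistrib W X P =ᵐ[P.map X] fun _ => P.map W := by
  have : IsProbabilityMeasure (P.map W) := Measure.isProbabilityMeasure_map hW.aemeasurable
  refine condDistrib_ae_eq_of_measure_eq_compProd (κ := Kernel.const β (P.map W)) X hW.aemeasurable ?_
  rw [Measure.compProd_const]
  exact (indepFun_iff_map_prod_eq_prod_map_map hX.aemeasurable hW.aemeasurable).1 h

/-- `A` may depend on `X` and `U` arbitrarily: the sum equals `x` only if `U ∈ {x, x - 1}`, a null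
set for the conditional law of `U`, which is its own law by independence. -/
lemma ae_nullSingletonClass_condDistrib_add_indicator (hX : Measurable X) {U : Ω → ℝ} (hU : Measurable U)
    (hXU : IndepFun X U P) [NullSingletonClass (P.map U)] {A : Set Ω} (hA : MeasurableSet A) :
    ∀ᵐ b ∂P.map X, NullSingletonClass (condDistrib (fun ω => U ω + A.indicator (fun _ => 1) ω) X P b) := by
  classical
  let Y : Ω → ℝ × Bool := fun ω => (U ω, decide (ω ∈ A))
  have hY : Measurable Y := hU.prodMk
    (measurable_to_bool (by simpa [Set.preimage, Set.mem_singleton_iff] using hA))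
  let f : ℝ × Bool → ℝ := fun p => p.1 + if p.2 then 1 else 0
  have hf : Measurable f :=
    measurable_fst.add (measurable_of_countable (fun b : Bool => if b then (1 : ℝ) else 0) |>.comp
      measurable_snd)
  have hfY : f ∘ Y = fun ω => U ω + A.indicator (fun _ => 1) ω := by
    ext ω
    by_cases h : ω ∈ A <;> simp [f, Y, h]
  have h1 := condDistrib_comp (mβ := mβ) X (μ := P) hY.aemeasurable hf
  have h2 := condDistrib_comp (mβ := mβ) X (μ := P) hY.aemeasurable (measurable_fst (α := ℝ) (β := Bool))
  have h3 := condDistrib_ae_eq_map_of_indepFun hX hU hXU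
  rw [hfY] at h1
  filter_upwards [h1, h2, h3] with b e1 e2 e3
  have e4 : (condDistrib Y X P b).map Prod.fst = P.map U := by
    rw [← e3, ← Kernel.map_apply _ measurable_fst, ← e2]; rfl
  refine ⟨fun x => ?_⟩
  rw [e1, Kernel.map_apply _ hf, Measure.map_apply hf (measurableSet_singleton x)]
  refine measure_mono_null (t := Prod.fst ⁻¹' {x, x - 1}) ?_ ?_
  · rintro ⟨u, c⟩ h
    cases c
    · left; simpa [f] using h
    · right
      have : u + 1 = x := by simpa [f] using h
      exact eq_sub_of_add_eq this
  · rw [← Measure.map_apply measurable_fst ((Set.toFinite _).measurableSet), e4]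
    exact (Set.toFinite _).measure_zero _

end ConditionalQuantile

lemma MeasureTheory.MemLp.eLpNorm_sq_eq_ofReal {Ω E : Type*} {mΩ : MeasurableSpace Ω}
    {P : Measure Ω} [NormedAddCommGroup E] {f : Ω → E} (hf : MemLp f 2 P) :
    eLpNorm f 2 P ^ 2 = ENNReal.ofReal (‖hf.toLp f‖ ^ 2) := by
  rw [Lp.norm_toLp, ← ENNReal.toReal_pow, ENNReal.ofReal_toReal (by finiteness [hf.2.ne])]

/-! ### An independent variable correlated with a given one -/

section Correlation

variable {Ω β : Type*} {F G : MeasurableSpace Ω} {mΩ : MeasurableSpace Ω} {P : Measure Ω}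
  [IsProbabilityMeasure P]

lemma integral_mul_eq_zero_of_condExp_eq_zero (hF : F ≤ mΩ) {c R : Ω → ℝ}
    (hc : Measurable[F] c) {C : ℝ} (hcC : ∀ ω, ‖c ω‖ ≤ C) (hR : Integrable R P)
    (hR0 : P[R | F] =ᵐ[P] 0) : ∫ ω, c ω * R ω ∂P = 0 := by
  have hint : Integrable (c * R) P :=
    hR.bdd_mul (hc.mono hF le_rfl).aestronglyMeasurable (ae_of_all _ hcC)
  have h := condExp_mul_of_stronglyMeasurable_left hc.stronglyMeasurable hint hR
  have h0 : P[c * R | F] =ᵐ[P] 0 := h.trans (hR0.mono fun ω hω => by simp [hω])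
  calc ∫ ω, c ω * R ω ∂P = ∫ ω, P[c * R | F] ω ∂P := (integral_condExp hF).symm
    _ = 0 := by rw [integral_congr_ae h0]; simp

/-- `W = U + 1_{R > 0}` is at least `1` where `R > 0` and at most `1` elsewhere. Its conditional
quantile transform `V` keeps this order relative to the threshold `c (X)`, the transform of `1`, so
`(V - c (X)) * R ≥ 0`; and `c (X) * R` integrates to zero. -/
lemma exists_indepFun_integral_mul_pos {mβ : MeasurableSpace β}
    (hG : G ≤ mΩ) {X : Ω → β} (hX : Measurable[G] X) {U : Ω → ℝ} (hU : Measurable[G] U)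
    (hUX : IndepFun X U P) [NullSingletonClass (P.map U)] (hU01 : ∀ᵐ ω ∂P, U ω ∈ Set.Icc 0 1)
    {R : Ω → ℝ} (hRG : Measurable[G] R) (hR : Integrable R P)
    (hR0 : P[R | mβ.comap X] =ᵐ[P] 0) (hRne : ¬ R =ᵐ[P] 0) :
    ∃ V : Ω → ℝ, Measurable[G] V ∧ (∀ ω, V ω ∈ Set.Icc 0 1) ∧ IndepFun V X P ∧
      0 < ∫ ω, V ω * R ω ∂P := by
  set A : Set Ω := {ω | 0 < R ω}
  have hA : MeasurableSet[G] A := hRG measurableSet_Ioi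
  set W : Ω → ℝ := fun ω => U ω + A.indicator (fun _ => 1) ω
  have hW : Measurable[G] W := hU.add (measurable_const.indicator hA)
  have hXm := hX.mono hG le_rfl
  have hWm := hW.mono hG le_rfl
  have hna := ae_nullSingletonClass_condDistrib_add_indicator hXm (hU.mono hG le_rfl) hUX (hG A hA)
  set κ := condDistrib W X P
  set V : Ω → ℝ := fun ω => (κ (X ω)).real (Set.Iic (W ω))
  set c : β → ℝ := fun b => (κ b).real (Set.Iic 1)
  have hc : Measurable c := (Kernel.measurable_coe κ measurableSet_Iic).ennreal_toReal
  have hV : Measurable[G] V := (measurable_kernel_real_Iic κ).comp (hX.prodMk hW)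
  have hV01 : ∀ ω, V ω ∈ Set.Icc 0 1 := fun ω => ⟨measureReal_nonneg, measureReal_le_one⟩
  have hVb : ∀ ω, ‖V ω‖ ≤ 1 := fun ω => by
    rw [Real.norm_of_nonneg (hV01 ω).1]; exact (hV01 ω).2
  have hcb : ∀ ω, ‖c (X ω)‖ ≤ 1 := fun ω => by
    rw [Real.norm_of_nonneg measureReal_nonneg]; exact measureReal_le_one
  have hne : ∀ᵐ ω ∂P, V ω ≠ c (X ω) := ae_kernel_real_Iic_ne hXm hWm hna hc
  refine ⟨V, hV, hV01, indepFun_kernel_real_Iic hXm hWm hna, ?_⟩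
  have hVR : Integrable (fun ω => V ω * R ω) P :=
    hR.bdd_mul (hV.mono hG le_rfl).aestronglyMeasurable (ae_of_all _ hVb)
  have hcR : Integrable (fun ω => c (X ω) * R ω) P :=
    hR.bdd_mul (hc.comp hXm).aestronglyMeasurable (ae_of_all _ hcb)
  have hcR0 : ∫ ω, c (X ω) * R ω ∂P = 0 := integral_mul_eq_zero_of_condExp_eq_zero
    hXm.comap_le (hc.comp (comap_measurable X)) hcb hR hR0
  have heq : ∫ ω, V ω * R ω ∂P = ∫ ω, (V ω - c (X ω)) * R ω ∂P := by
    simp_rw [sub_mul]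
    rw [integral_sub hVR hcR, hcR0, sub_zero]
  have hint : Integrable (fun ω => (V ω - c (X ω)) * R ω) P := by
    simp_rw [sub_mul]
    exact hVR.sub hcR
  have hnonneg : 0 ≤ᵐ[P] fun ω => (V ω - c (X ω)) * R ω := by
    filter_upwards [hU01] with ω hω
    by_cases h : ω ∈ A
    · have : 1 ≤ W ω := by simp [W, h, hω.1]
      exact mul_nonneg (sub_nonneg.2 (measureReal_mono (Set.Iic_subset_Iic.2 this))) (le_of_lt h)
    · have : W ω ≤ 1 := by simp [W, h, hω.2]
      exact mul_nonneg_of_nonpos_of_nonpos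
        (sub_nonpos.2 (measureReal_mono (Set.Iic_subset_Iic.2 this))) (not_lt.1 h)
  rw [heq]
  refine (integral_nonneg_of_ae hnonneg).lt_of_ne fun h0 => hRne ?_
  filter_upwards [(integral_eq_zero_iff_of_nonneg_ae hnonneg hint).1 h0.symm, hne] with ω h1 h2
  exact (mul_eq_zero.1 h1).resolve_left (sub_ne_zero.2 h2)

end Correlation

/-! ### Innovations and their ambient closed subspace -/

section OneStep


/-- The square integrable centered innovations of `G` over `F`. -/
structure IsInnovation {Ω E : Type*} [NormedAddCommGroup E] [NormedSpace ℝ E] [MeasurableSpace E]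
    (F G : MeasurableSpace Ω) {mΩ : MeasurableSpace Ω} (P : Measure Ω) (Y : Ω → E) : Prop where
  stronglyMeasurable : StronglyMeasurable[G] Y
  memLp : MemLp Y 2 P
  indep : Indep (MeasurableSpace.comap Y inferInstance) F P
  integral_eq_zero : ∫ ω, Y ω ∂P = 0

lemma MeasureTheory.StronglyMeasurable.stronglyMeasurable_comap {Ω E : Type*} [TopologicalSpace E]
    [TopologicalSpace.PseudoMetrizableSpace E] [MeasurableSpace E] [BorelSpace E]
    {G : MeasurableSpace Ω} {Y : Ω → E} (hY : StronglyMeasurable[G] Y) :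
    StronglyMeasurable[MeasurableSpace.comap Y inferInstance] Y :=
  stronglyMeasurable_iff_measurable_separable.2
    ⟨comap_measurable Y, hY.isSeparable_range⟩

variable {Ω : Type*} {F G : MeasurableSpace Ω} {mΩ : MeasurableSpace Ω} {P : Measure Ω}
  {E : Type*} [NormedAddCommGroup E] [InnerProductSpace ℝ E]

section Innovation

variable [MeasurableSpace E]

lemma IsInnovation.condExp_eq_zero [IsProbabilityMeasure P] [CompleteSpace E] [BorelSpace E]
    {Y : Ω → E} (hY : IsInnovation F G P Y) (hF : F ≤ mΩ)
    (hG : G ≤ mΩ) : P[Y | F] =ᵐ[P] 0 := by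
  have h := condExp_indep_eq (hY.stronglyMeasurable.measurable.comap_le.trans hG) hF
    hY.stronglyMeasurable.stronglyMeasurable_comap hY.indep
  rw [hY.integral_eq_zero] at h
  exact h

lemma isInnovation_zero [IsProbabilityMeasure P] : IsInnovation F G P (0 : Ω → E) where
  stronglyMeasurable := stronglyMeasurable_zero
  memLp := MemLp.zero
  indep := by
    have : MeasurableSpace.comap (0 : Ω → E) inferInstance = ⊥ := MeasurableSpace.comap_const 0
    rw [this]
    exact indep_bot_left F
  integral_eq_zero := by simp

lemma IsInnovation.const_smul [BorelSpace E] {Y : Ω → E} (hY : IsInnovation F G P Y) (c : ℝ) :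
    IsInnovation F G P (c • Y) where
  stronglyMeasurable := hY.stronglyMeasurable.const_smul c
  memLp := hY.memLp.const_smul c
  indep := indep_of_indep_of_le_left hY.indep <| by
    have : c • Y = (fun y : E => c • y) ∘ Y := rfl
    rw [this, ← MeasurableSpace.comap_comp]
    exact MeasurableSpace.comap_mono (measurable_const_smul c).comap_le
  integral_eq_zero := by
    simp only [Pi.smul_apply, integral_smul, hY.integral_eq_zero, smul_zero]

end Innovation

/-- The square integrable functions that are measurable with respect to `G` and have vanishing
conditional expectation given `F`. -/
noncomputable def lpMeasCentered {Ω : Type*} (E : Type*) [NormedAddCommGroup E]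
    [InnerProductSpace ℝ E] [CompleteSpace E] {F : MeasurableSpace Ω} (G : MeasurableSpace Ω)
    {mΩ : MeasurableSpace Ω} (hF : F ≤ mΩ) (P : Measure Ω) :
    Submodule ℝ (Lp E 2 P) :=
  lpMeas E ℝ G 2 P ⊓ LinearMap.ker (condExpL2 E ℝ hF).toLinearMap

variable [CompleteSpace E]

lemma isClosed_lpMeasCentered (hF : F ≤ mΩ) (hG : G ≤ mΩ) :
    IsClosed (lpMeasCentered E G hF P : Set (Lp E 2 P)) :=
  (isClosed_aestronglyMeasurable hG).inter (condExpL2 E ℝ hF).isClosed_ker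

lemma toLp_mem_lpMeasCentered_iff [IsProbabilityMeasure P] (hF : F ≤ mΩ) {Y : Ω → E} (hY : MemLp Y 2 P) :
    hY.toLp Y ∈ lpMeasCentered E G hF P ↔ AEStronglyMeasurable[G] Y P ∧ P[Y | F] =ᵐ[P] 0 := by
  have h1 : hY.toLp Y ∈ lpMeas E ℝ G 2 P ↔ AEStronglyMeasurable[G] Y P := by
    rw [mem_lpMeas_iff_aestronglyMeasurable]
    exact ⟨fun h => h.congr hY.coeFn_toLp, fun h => h.congr hY.coeFn_toLp.symm⟩
  have h2 : condExpL2 E ℝ hF (hY.toLp Y) = 0 ↔ P[Y | F] =ᵐ[P] 0 := by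
    have h := hY.condExpL2_ae_eq_condExp (𝕜 := ℝ) hF
    rw [← Submodule.coe_eq_zero, Lp.eq_zero_iff_ae_eq_zero]
    exact ⟨fun h' => h.symm.trans h', fun h' => h.trans h'⟩
  exact and_congr h1 h2

end OneStep

/-! ### Expansion of one increment -/

section Euclidean

variable {Ω : Type*} {F G : MeasurableSpace Ω} {mΩ : MeasurableSpace Ω} {P : Measure Ω}
  [IsProbabilityMeasure P] {m : ℕ}

local notation "𝔼" => EuclideanSpace ℝ (Fin m)

lemma eq_zero_of_forall_inner_isInnovation_eq_zero (hFG : F ≤ G) (hG : G ≤ mΩ) {U : Ω → ℝ}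
    (hU : Measurable[G] U) (hunif : pdf.IsUniform U (Set.Icc 0 1) P volume)
    (hind : Indep (MeasurableSpace.comap U inferInstance) F P) {z : Lp 𝔼 2 P}
    (hz : z ∈ lpMeasCentered 𝔼 G (hFG.trans hG) P)
    (hperp : ∀ Y : Ω → 𝔼, ∀ hY : IsInnovation F G P Y, inner ℝ z (hY.memLp.toLp Y) = 0) :
    z = 0 := by
  have hF := hFG.trans hG
  have hzL := Lp.memLp z
  rw [← Lp.toLp_coeFn z hzL, toLp_mem_lpMeasCentered_iff hF hzL] at hz
  obtain ⟨⟨Z, hZG, hzZ⟩, hz0⟩ := hz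
  have hZL : MemLp Z 2 P := hzL.ae_eq hzZ
  have hZ0 : P[Z | F] =ᵐ[P] 0 := (condExp_congr_ae hzZ).symm.trans hz0
  have hZint : Integrable Z P := hZL.integrable one_le_two
  have : NullSingletonClass (P.map U) := ⟨fun x => by
    exact hunif.absolutelyContinuous (measure_singleton x)⟩
  have hU01 : ∀ᵐ ω ∂P, U ω ∈ Set.Icc 0 1 := by
    have h : ∀ᵐ x ∂P.map U, x ∈ Set.Icc (0 : ℝ) 1 := by
      rw [hunif]
      exact ae_cond_mem measurableSet_Icc
    exact ae_of_ae_map (hU.mono hG le_rfl).aemeasurable h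
  have hcoord : ∀ i, (fun ω => Z ω i) =ᵐ[P] 0 := fun i => by
    by_contra hne
    let T : 𝔼 →L[ℝ] ℝ := EuclideanSpace.proj i
    have hR0 : P[fun ω => Z ω i | F] =ᵐ[P] 0 :=
      (T.comp_condExp_comm hZint).symm.trans (hZ0.mono fun ω hω => by simp [hω])
    have hRint : Integrable (fun ω => Z ω i) P := T.integrable_comp hZint
    have hRG : Measurable[G] fun ω => Z ω i := T.continuous.measurable.comp hZG.measurable
    -- The identity, with `F` on its codomain, serves as the conditioning variable, so conditioning
    -- on it is conditioning on `F`.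
    have hid : Measurable[G, F] (id : Ω → Ω) := measurable_id'' hFG
    have hUid : @IndepFun Ω Ω ℝ mΩ F _ id U P := by
      refine (@IndepFun_iff_Indep Ω Ω ℝ mΩ F _ id U P).2 ?_
      rw [MeasurableSpace.comap_id]
      exact hind.symm
    obtain ⟨V, hVG, hV01, hVind, hpos⟩ := exists_indepFun_integral_mul_pos (mβ := F) hG hid hU hUid
      hU01 hRG hRint (by rwa [MeasurableSpace.comap_id]) hne
    replace hVind := (@IndepFun_iff_Indep Ω ℝ Ω mΩ _ F V id P).1 hVind
    rw [MeasurableSpace.comap_id] at hVind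
    have hVm := hVG.mono hG le_rfl
    have hVL : MemLp V 2 P := MemLp.of_bound hVm.aestronglyMeasurable 1 (ae_of_all _ fun ω => by
      rw [Real.norm_of_nonneg (hV01 ω).1]; exact (hV01 ω).2)
    set a := ∫ ω, V ω ∂P
    set e : 𝔼 := EuclideanSpace.single i 1
    -- Centering `V` makes an innovation along coordinate `i`; it does not change the pairing with
    -- `Z`, whose coordinates have mean zero.
    let φ : ℝ → 𝔼 := fun v => (v - a) • e
    have hφ : Continuous φ := (continuous_id.sub continuous_const).smul continuous_const
    have hY : IsInnovation F G P (φ ∘ V) :=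
      { stronglyMeasurable := hφ.comp_stronglyMeasurable hVG.stronglyMeasurable
        memLp := (ContinuousLinearMap.toSpanSingleton ℝ e).comp_memLp' (hVL.sub (memLp_const a))
        indep := indep_of_indep_of_le_left hVind <| by
          rw [← MeasurableSpace.comap_comp]
          exact MeasurableSpace.comap_mono hφ.measurable.comap_le
        integral_eq_zero := by
          have : ∫ ω, (V ω - a) ∂P = 0 := by
            rw [integral_sub (hVL.integrable one_le_two) (integrable_const a)]
            simp [a]
          simp only [φ, Function.comp_def]
          rw [integral_smul_const, this, zero_smul] }
    have h0 := hperp _ hY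
    have hZi : ∫ ω, Z ω i ∂P = 0 := by
      rw [← integral_condExp hF, integral_congr_ae hR0]; simp
    have hVZ : Integrable (fun ω => V ω * Z ω i) P :=
      hRint.bdd_mul (c := 1) hVm.aestronglyMeasurable (ae_of_all _ fun ω => by
        rw [Real.norm_of_nonneg (hV01 ω).1]; exact (hV01 ω).2)
    rw [L2.inner_def] at h0
    have h1 : ∫ ω, inner ℝ (z ω) ((hY.memLp.toLp _ : Lp 𝔼 2 P) ω) ∂P =
        ∫ ω, (V ω * Z ω i - a * Z ω i) ∂P := by
      refine integral_congr_ae ?_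
      filter_upwards [hzZ, hY.memLp.coeFn_toLp] with ω h1 h2
      rw [h1, h2]
      simp [φ, e, inner_smul_right, EuclideanSpace.inner_single_right]
      ring
    rw [h1, integral_sub hVZ (hRint.const_mul a), integral_const_mul, hZi] at h0
    linarith
  have hall : ∀ᵐ ω ∂P, ∀ i, Z ω i = 0 := ae_all_iff.2 hcoord
  rw [Lp.eq_zero_iff_ae_eq_zero]
  filter_upwards [hzZ, hall] with ω h1 h2
  rw [h1]
  ext i
  exact h2 i

/-- A square integrable function with vanishing conditional expectation is the sum of a series of
centered innovations satisfying Parseval's identity. -/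
theorem exists_isInnovation_tendsto_tsum (hFG : F ≤ G) (hG : G ≤ mΩ) {U : Ω → ℝ}
    (hU : Measurable[G] U) (hunif : pdf.IsUniform U (Set.Icc 0 1) P volume)
    (hind : Indep (MeasurableSpace.comap U inferInstance) F P) {D : Ω → 𝔼} (hD : MemLp D 2 P)
    (hDG : AEStronglyMeasurable[G] D P) (hD0 : P[D | F] =ᵐ[P] 0) :
    ∃ Y : ℕ → Ω → 𝔼, (∀ n, IsInnovation F G P (Y n)) ∧
      Tendsto (fun N : ℕ => eLpNorm (D - ∑ n ∈ Finset.range N, Y n) 2 P) atTop (𝓝 0) ∧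
      eLpNorm D 2 P ^ 2 = ∑' n, eLpNorm (Y n) 2 P ^ 2 := by
  have hF := hFG.trans hG
  obtain ⟨y, hyS, hy1, hy2⟩ := exists_hasSum_sq_norm_of_cone
    (S := {y | ∃ Y : Ω → 𝔼, ∃ hY : IsInnovation F G P Y, hY.memLp.toLp Y = y})
    (lpMeasCentered 𝔼 G hF P) (isClosed_lpMeasCentered hF hG)
    (by
      rintro _ ⟨Y, hY, rfl⟩
      exact (toLp_mem_lpMeasCentered_iff hF _).2
        ⟨hY.stronglyMeasurable.aestronglyMeasurable, hY.condExp_eq_zero hF hG⟩)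
    ⟨0, isInnovation_zero, MemLp.toLp_zero _⟩
    (by
      rintro _ ⟨Y, hY, rfl⟩ c
      exact ⟨c • Y, hY.const_smul c, MemLp.toLp_const_smul c hY.memLp⟩)
    (fun z hz hperp => eq_zero_of_forall_inner_isInnovation_eq_zero hFG hG hU hunif hind hz
      fun Y hY => hperp _ ⟨Y, hY, rfl⟩)
    ((toLp_mem_lpMeasCentered_iff hF hD).2 ⟨hDG, hD0⟩)
  choose Y hY hYy using hyS
  refine ⟨Y, hY, ?_, ?_⟩
  · have hsum : ∀ N, MemLp (∑ n ∈ Finset.range N, Y n) 2 P := fun N =>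
      memLp_finsetSum' _ fun n _ => (hY n).memLp
    have hsum' : ∀ N, (hsum N).toLp _ = ∑ n ∈ Finset.range N, y n := fun N => by
      induction N with
      | zero => simp only [Finset.range_zero, Finset.sum_empty]; exact MemLp.toLp_zero _
      | succ N ih =>
        simp_rw [Finset.sum_range_succ]
        rw [MemLp.toLp_add (hsum N) (hY N).memLp, ih, hYy]
    have h := (Lp.tendsto_Lp_iff_tendsto_eLpNorm'' (fun N => ∑ n ∈ Finset.range N, Y n) hsum D
      hD).1 (by simpa only [hsum'] using hy1)
    refine h.congr fun N => ?_
    rw [← eLpNorm_neg, neg_sub]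
  · rw [hD.eLpNorm_sq_eq_ofReal, ← hy2.tsum_eq, ENNReal.ofReal_tsum_of_nonneg (fun _ => sq_nonneg _) hy2.summable]
    exact tsum_congr fun n => by
      rw [(hY n).memLp.eLpNorm_sq_eq_ofReal, hYy]

end Euclidean

/-! ### From one step to the whole filtration -/

section Filtration

variable {Ω : Type*} {mΩ : MeasurableSpace Ω} {P : Measure Ω} [IsProbabilityMeasure P]

/-- The Pythagorean theorem for a function with vanishing conditional expectation. -/
lemma eLpNorm_add_sq_of_condExp_eq_zero {E : Type*} [NormedAddCommGroup E] [InnerProductSpace ℝ E]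
    [CompleteSpace E] {F : MeasurableSpace Ω} (hF : F ≤ mΩ) {f g : Ω → E} (hf : MemLp f 2 P)
    (hfF : AEStronglyMeasurable[F] f P) (hg : MemLp g 2 P) (hg0 : P[g | F] =ᵐ[P] 0) :
    eLpNorm (f + g) 2 P ^ 2 = eLpNorm f 2 P ^ 2 + eLpNorm g 2 P ^ 2 := by
  have hinner : inner ℝ (hf.toLp f) (hg.toLp g) = 0 := by
    have h := inner_condExpL2_eq_inner_fun (𝕜 := ℝ) hF (hg.toLp g) (hf.toLp f)
      (hfF.congr hf.coeFn_toLp.symm)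
    have h0 : condExpL2 E ℝ hF (hg.toLp g) = 0 := by
      rw [← Submodule.coe_eq_zero, Lp.eq_zero_iff_ae_eq_zero]
      exact (hg.condExpL2_ae_eq_condExp (𝕜 := ℝ) hF).trans hg0
    rw [real_inner_comm, ← h, h0, Submodule.coe_zero, inner_zero_left]
  rw [(hf.add hg).eLpNorm_sq_eq_ofReal, hf.eLpNorm_sq_eq_ofReal, hg.eLpNorm_sq_eq_ofReal,
    ← ENNReal.ofReal_add (sq_nonneg _) (sq_nonneg _), MemLp.toLp_add hf hg, norm_add_sq_real,
    hinner, mul_zero, add_zero]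

/-- A sequence of functions, each independent of the past of a filtration, is independent. -/
lemma iIndepFun_of_indep_filtration {E : Type*} [MeasurableSpace E] (ℱ : Filtration ℕ mΩ)
    {f : ℕ → Ω → E} (hf : ∀ k, Measurable[ℱ (k + 1)] (f k))
    (hind : ∀ k, Indep (MeasurableSpace.comap (f k) inferInstance) (ℱ k) P) : iIndepFun f P := by
  rw [iIndepFun_iff_measure_inter_preimage_eq_mul]
  intro S
  -- Split off the largest index `a`: the events with index `i < a` lie in `ℱ (i + 1) ≤ ℱ a`.
  induction S using Finset.induction_on_max with
  | empty => simp
  | insert a s hmax ih =>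
    intro sets hsets
    have ha : a ∉ s := fun h => lt_irrefl a (hmax a h)
    rw [Finset.set_biInter_insert, Finset.prod_insert ha,
      ← ih fun i hi => hsets i (Finset.mem_insert_of_mem hi)]
    refine (Indep_iff _ _ _).1 (hind a) _ _
      ⟨_, hsets a (Finset.mem_insert_self a s), rfl⟩ ?_
    exact Finset.measurableSet_biInter s fun i hi =>
      ℱ.mono (Nat.succ_le_of_lt (hmax i hi)) _ (hf i (hsets i (Finset.mem_insert_of_mem hi)))

end Filtration

theorem theorem1 {Ω : Type*} {mΩ : MeasurableSpace Ω} (P : Measure Ω) [IsProbabilityMeasure P]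
    (ℱ : Filtration ℕ mΩ) (hℱ : HasAtomlessInnovations ℱ P) (m : ℕ)
    (X : ℕ → Ω → EuclideanSpace ℝ (Fin m)) (hX : Martingale X ℱ P)
    (hX2 : ∀ k, MemLp (X k) 2 P) (hX0 : X 0 =ᵐ[P] 0) :
    ∃ Z : ℕ → ℕ → Ω → EuclideanSpace ℝ (Fin m),
      (∀ n, Martingale (Z n) ℱ P) ∧
      (∀ n k, MemLp (Z n k) 2 P) ∧
      (∀ n, Z n 0 = 0) ∧
      (∀ n k, Indep (MeasurableSpace.comap (Z n (k + 1) - Z n k) inferInstance) (ℱ k) P) ∧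
      (∀ k, Tendsto (fun N : ℕ => eLpNorm (X k - ∑ n ∈ Finset.range N, Z n k) 2 P)
        atTop (𝓝 0)) ∧
      (∀ k, eLpNorm (X k) 2 P ^ 2 = ∑' n, eLpNorm (Z n k) 2 P ^ 2) ∧
      (∀ n, iIndepFun (fun k : ℕ => Z n (k + 1) - Z n k) P) := by
  have hD2 : ∀ k, MemLp (X (k + 1) - X k) 2 P := fun k => (hX2 _).sub (hX2 _)
  have hD0 : ∀ k, P[X (k + 1) - X k | ℱ k] =ᵐ[P] 0 := fun k => by
    refine (condExp_sub (hX.integrable _) (hX.integrable _) _).trans ?_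
    filter_upwards [hX.condExp_ae_eq k.le_succ, hX.condExp_ae_eq (le_refl k)] with ω h1 h2
    simp [h1, h2]
  have hstep : ∀ k, ∃ Y : ℕ → Ω → EuclideanSpace ℝ (Fin m),
      (∀ n, IsInnovation (ℱ k) (ℱ (k + 1)) P (Y n)) ∧
      Tendsto (fun N : ℕ => eLpNorm (X (k + 1) - X k - ∑ n ∈ Finset.range N, Y n) 2 P)
        atTop (𝓝 0) ∧
      eLpNorm (X (k + 1) - X k) 2 P ^ 2 = ∑' n, eLpNorm (Y n) 2 P ^ 2 := fun k => by
    obtain ⟨U, hU, hunif, hind⟩ := hℱ k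
    refine exists_isInnovation_tendsto_tsum (ℱ.mono k.le_succ) (ℱ.le _) hU hunif hind (hD2 k) ?_
      (hD0 k)
    exact ((hX.stronglyMeasurable _).sub
      ((hX.stronglyMeasurable k).mono (ℱ.mono k.le_succ))).aestronglyMeasurable
  choose Y hY hYlim hYsq using hstep
  let Z : ℕ → ℕ → Ω → EuclideanSpace ℝ (Fin m) := fun n k => ∑ j ∈ Finset.range k, Y j n
  have hZsucc : ∀ n k, Z n (k + 1) = Z n k + Y k n := fun n k => Finset.sum_range_succ _ _
  have hZsub : ∀ n k, Z n (k + 1) - Z n k = Y k n := fun n k => by rw [hZsucc, add_sub_cancel_left]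
  have hZ2 : ∀ n k, MemLp (Z n k) 2 P := fun n k => memLp_finsetSum' _ fun j _ => (hY j n).memLp
  have hZm : ∀ n k, StronglyMeasurable[ℱ k] (Z n k) := fun n k =>
    Finset.stronglyMeasurable_sum _ fun j hj => (hY j n).stronglyMeasurable.mono
      (ℱ.mono (Nat.succ_le_of_lt (Finset.mem_range.1 hj)))
  have hY0 : ∀ n k, P[Y k n | ℱ k] =ᵐ[P] 0 := fun n k =>
    (hY k n).condExp_eq_zero (ℱ.le _) (ℱ.le _)
  refine ⟨Z, fun n => ?_, hZ2, fun n => ?_, fun n k => ?_, fun k => ?_, fun k => ?_, fun n => ?_⟩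
  · refine martingale_of_condExp_sub_eq_zero_nat (hZm n)
      (fun k => (hZ2 n k).integrable one_le_two) fun k => ?_
    rw [hZsub]
    exact hY0 n k
  · exact Finset.sum_range_zero _
  · rw [hZsub]
    exact (hY k n).indep
  · induction k with
    | zero =>
      refine tendsto_const_nhds.congr fun N => ?_
      have : X 0 - ∑ n ∈ Finset.range N, Z n 0 =ᵐ[P] 0 := by simpa [Z] using hX0
      rw [eLpNorm_congr_ae this, eLpNorm_zero]
    | succ k ih =>
      have hsum : ∀ N, X (k + 1) - ∑ n ∈ Finset.range N, Z n (k + 1) =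
          (X k - ∑ n ∈ Finset.range N, Z n k) +
            (X (k + 1) - X k - ∑ n ∈ Finset.range N, Y k n) := fun N => by
        simp_rw [hZsucc, Finset.sum_add_distrib]
        abel
      have hlim := ih.add (hYlim k)
      rw [add_zero] at hlim
      refine tendsto_of_tendsto_of_tendsto_of_le_of_le tendsto_const_nhds hlim
        (fun _ => zero_le) fun N => ?_
      simp only [hsum]
      exact eLpNorm_add_le
        ((hX2 k).sub (memLp_finsetSum' _ fun n _ => hZ2 n k)).aestronglyMeasurable
        ((hD2 k).sub (memLp_finsetSum' _ fun n _ => (hY k n).memLp)).aestronglyMeasurable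
        one_le_two
  · induction k with
    | zero => simp [Z, eLpNorm_congr_ae hX0]
    | succ k ih =>
      have hXs := eLpNorm_add_sq_of_condExp_eq_zero (ℱ.le k) (hX2 k)
        (hX.stronglyMeasurable k).aestronglyMeasurable (hD2 k) (hD0 k)
      rw [add_sub_cancel] at hXs
      rw [hXs, ih, hYsq, ← ENNReal.tsum_add]
      -- The same Pythagorean split at time `k` applies to each `Z n`, matching the two series
      -- termwise.
      refine tsum_congr fun n => ?_
      rw [hZsucc, eLpNorm_add_sq_of_condExp_eq_zero (ℱ.le k) (hZ2 n k)
        (hZm n k).aestronglyMeasurable (hY k n).memLp (hY0 n k)]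
  · simp_rw [hZsub]
    exact iIndepFun_of_indep_filtration ℱ (fun k => (hY k n).stronglyMeasurable.measurable)
      fun k => (hY k n).indep
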